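/- Let $k$ be an algebraically closed field, $B$ a finite dimensional $k$-algebra, $P_0$ a finitely generated projective left $B$-module, and $A=B[P_0]=\begin{pmatrix}B&P_0\\0&k\end{pmatrix}$ the one-point extension. For a ring $R$ let $\mathrm{Mod}\text{-}R$ denote the category of all left $R$-modules. Let $e_B\in A$ be the identity of $B$, let $\mathcal R=\mathrm{Hom}_A(Ae_B,-):\mathrm{Mod}\text{-}A\to\mathrm{Mod}\text{-}B$ be the restriction functor, let $S$ be the simple injective $A$-module $k$ on which $A$ acts through its lower right entry, and let $S^{\mathrm{perp}}$ be the full subcategory of all $X\in\mathrm{Mod}\text{-}A$ with $\mathrm{Hom}_A(S,X)=0$ and $\mathrm{Ext}^1_A(S,X)=0$. For a full subcategory $\mathscr X$ of $\mathrm{Mod}\text{-}A$, $\mathcal R\mathscr X$ denotes the class of all $B$-modules isomorphic to $\mathcal RX$ for some $X\in\mathscr X$. For a full subcategory $\mathscr X$ of an abelian category $\mathscr A$ let $\mathrm{Fac}(\mathscr X)$ be the class of all epimorphic images of direct summands of finite direct sums of objects of $\mathscr X$, and put ${}^{\perp_1}\mathscr X=\{M:\mathrm{Ext}^1_{\mathscr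 A}(M,\mathscr X)=0\}$ and $\mathscr X^{\perp_0}=\{M:\mathrm{Hom}_{\mathscr A}(\mathscr X,M)=0\}$. A right $\mathscr X$-approximation of $M$ is a morphism $X\to M$ with $X\in\mathscr X$ through which every morphism $X'\to M$ with $X'\in\mathscr X$ factors; left $\mathscr X$-approximations are defined dually; $\mathscr X$ is contravariantly finite if every object of $\mathscr A$ has a right $\mathscr X$-approximation. A triple $(\mathscr C,\mathscr T,\mathscr F)$ of full subcategories of an abelian category $\mathscr A$ with enough projectives is a *$\tau$-cotorsion torsion triple* if 1. $\mathscr C\cap\mathscr T$ is contravariantly finite in $\mathscr A$, $\mathscr C={}^{\perp_1}\mathscr T$, and for every projective object $P$ there is an exact sequence $P\xrightarrow{f}D\to C\to0$ with $D\in\mathscr C\cap\mathscr T$, $C\in\mathscr C$ and $f$ a left $\mathscr T$-approximation; and 2. $(\mathscr T,\mathscr F)$ is a torsion pair, i.e. $\mathrm{Hom}_{\mathscr A}(\mathscr T,\mathscr F)=0$ and every object $M$ admits a short exact sequence $0\to tM\to M\to fM\to0$ with $tM\in\mathscr T$ and $fM\in\mathscr F$. **Theorem.** Let $(\mathscr C,\mathscr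 T,\mathscr F)$ be a $\tau$-cotorsion torsion triple in $\mathrm{Mod}\text{-}A$. Then $$\bigl({}^{\perp_1}\mathrm{Fac}(\mathcal R(\mathscr C\cap\mathscr T)),\ \mathrm{Fac}(\mathcal R(\mathscr C\cap\mathscr T)),\ (\mathcal R(\mathscr C\cap\mathscr T))^{\perp_0}\bigr)$$ is a $\tau$-cotorsion torsion triple in $\mathrm{Mod}\text{-}B$. If furthermore $\mathscr T\subseteq S^{\mathrm{perp}}$, then $(\mathcal R\mathscr C,\mathcal R\mathscr T,\mathcal R(\mathscr F\cap S^{\mathrm{perp}}))$ is also a $\tau$-cotorsion torsion triple in $\mathrm{Mod}\text{-}B$, and the two triples coincide, i.e. ${}^{\perp_1}\mathrm{Fac}(\mathcal R(\mathscr C\cap\mathscr T))=\mathcal R\mathscr C$, $\mathrm{Fac}(\mathcal R(\mathscr C\cap\mathscr T))=\mathcal R\mathscr T$ and $(\mathcal R(\mathscr C\cap\mathscr T))^{\perp_0}=\mathcal R(\mathscr F\cap S^{\mathrm{perp}})$. -/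

import Mathlib

open CategoryTheory CategoryTheory.Limits

universe w v u

/-! ## Subcategories of an abelian category

A full subcategory is given by an `ObjectProperty`; intersections are `⊓`, inclusions are `≤`,
the essential image of `P` under a functor `F` is `P.map F`, and
`P.rightOrthogonal` consists of the `M` with `Hom(X, M) = 0` for all `X` in `P`. -/

namespace TauCot

section Abelian

variable {𝒜 : Type u} [Category.{v} 𝒜] [Abelian 𝒜]

attribute [local instance] Abelian.hasFiniteBiproducts

/-- `add P`: the objects isomorphic to a direct summand of a finite direct sum of objects of `P`. -/
def addClosure (P : ObjectProperty 𝒜) : ObjectProperty 𝒜 := fun Y =>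
  ∃ (n : ℕ) (X : Fin n → 𝒜), (∀ i, P (X i)) ∧ Nonempty (Retract Y (⨁ X))

/-- `Fac P`: the epimorphic images of objects of `add P`. -/
def Fac (P : ObjectProperty 𝒜) : ObjectProperty 𝒜 := fun M =>
  ∃ (Y : 𝒜) (p : Y ⟶ M), addClosure P Y ∧ Epi p

/-- The left `Ext¹`-perpendicular subcategory of `P`: all `M` with `Ext¹(M, X) = 0`
for every `X` in `P`. -/
def leftPerpOne [HasExt.{w} 𝒜] (P : ObjectProperty 𝒜) : ObjectProperty 𝒜 := fun M =>
  ∀ ⦃X : 𝒜⦄, P X → ∀ e : Abelian.Ext.{w} M X 1, e = 0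

/-- `f : X ⟶ M` is a right `P`-approximation of `M`. -/
def IsRightApproximation (P : ObjectProperty 𝒜) {X M : 𝒜} (f : X ⟶ M) : Prop :=
  P X ∧ ∀ ⦃X' : 𝒜⦄ (g : X' ⟶ M), P X' → ∃ h : X' ⟶ X, h ≫ f = g

/-- `f : M ⟶ X` is a left `P`-approximation of `M`. -/
def IsLeftApproximation (P : ObjectProperty 𝒜) {M X : 𝒜} (f : M ⟶ X) : Prop :=
  P X ∧ ∀ ⦃X' : 𝒜⦄ (g : M ⟶ X'), P X' → ∃ h : X ⟶ X', f ≫ h = g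

/-- Every object has a right `P`-approximation. -/
def IsContravariantlyFinite (P : ObjectProperty 𝒜) : Prop :=
  ∀ M : 𝒜, ∃ (X : 𝒜) (f : X ⟶ M), IsRightApproximation P f

/-- Torsion pairs `(𝒯, ℱ)`. -/
structure IsTorsionPair (𝒯 ℱ : ObjectProperty 𝒜) : Prop where
  hom_eq_zero : ∀ ⦃T F : 𝒜⦄, 𝒯 T → ℱ F → ∀ f : T ⟶ F, f = 0
  exists_shortExact : ∀ M : 𝒜, ∃ (T F : 𝒜) (i : T ⟶ M) (p : M ⟶ F) (zero : i ≫ p = 0),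
    𝒯 T ∧ ℱ F ∧ (ShortComplex.mk i p zero).ShortExact

/-- `τ`-cotorsion pairs `(𝒞, 𝒟)`. -/
structure IsTauCotorsionPair [HasExt.{w} 𝒜] (𝒞 𝒟 : ObjectProperty 𝒜) : Prop where
  contravariantlyFinite : IsContravariantlyFinite (𝒞 ⊓ 𝒟)
  eq_leftPerpOne : 𝒞 = leftPerpOne.{w} 𝒟
  exists_exact : ∀ P : 𝒜, Projective P →
    ∃ (D C : 𝒜) (f : P ⟶ D) (g : D ⟶ C) (zero : f ≫ g = 0),
      (𝒞 ⊓ 𝒟) D ∧ 𝒞 C ∧ (ShortComplex.mk f g zero).Exact ∧ Epi g ∧ IsLeftApproximation 𝒟 f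

/-- `τ`-cotorsion torsion triples `(𝒞, 𝒯, ℱ)`. -/
structure IsTauCotorsionTorsionTriple [HasExt.{w} 𝒜] (𝒞 𝒯 ℱ : ObjectProperty 𝒜) : Prop where
  tauCotorsionPair : IsTauCotorsionPair.{w} 𝒞 𝒯
  torsionPair : IsTorsionPair 𝒯 ℱ

end Abelian

end TauCot

/-! ## One-point extensions -/

/-- The one-point extension `B[P₀]`: upper triangular matrices with diagonal entries `b : B`,
`c : k` and upper right entry `p : P₀`. -/
@[ext]
structure OnePointExt (k B P₀ : Type u) where
  b : B
  p : P₀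
  c : k

namespace OnePointExt

set_option linter.unusedSectionVars false

section Algebra

variable {k B P₀ : Type u} [Field k] [Ring B] [Algebra k B] [AddCommGroup P₀] [Module B P₀]
  [Module k P₀]

instance : Zero (OnePointExt k B P₀) := ⟨⟨0, 0, 0⟩⟩
instance : One (OnePointExt k B P₀) := ⟨⟨1, 0, 1⟩⟩
instance : Add (OnePointExt k B P₀) := ⟨fun x y => ⟨x.b + y.b, x.p + y.p, x.c + y.c⟩⟩
instance : Neg (OnePointExt k B P₀) := ⟨fun x => ⟨-x.b, -x.p, -x.c⟩⟩

/-- Multiplication of upper triangular matrices; the right action of `k` on `P₀` is the scalar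
action of the field `k`. -/
instance : Mul (OnePointExt k B P₀) :=
  ⟨fun x y => ⟨x.b * y.b, x.b • y.p + y.c • x.p, x.c * y.c⟩⟩

@[simp] theorem zero_b : (0 : OnePointExt k B P₀).b = 0 := rfl
@[simp] theorem zero_p : (0 : OnePointExt k B P₀).p = 0 := rfl
@[simp] theorem zero_c : (0 : OnePointExt k B P₀).c = 0 := rfl
@[simp] theorem one_b : (1 : OnePointExt k B P₀).b = 1 := rfl
@[simp] theorem one_p : (1 : OnePointExt k B P₀).p = 0 := rfl
@[simp] theorem one_c : (1 : OnePointExt k B P₀).c = 1 := rfl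
@[simp] theorem add_b (x y : OnePointExt k B P₀) : (x + y).b = x.b + y.b := rfl
@[simp] theorem add_p (x y : OnePointExt k B P₀) : (x + y).p = x.p + y.p := rfl
@[simp] theorem add_c (x y : OnePointExt k B P₀) : (x + y).c = x.c + y.c := rfl
@[simp] theorem neg_b (x : OnePointExt k B P₀) : (-x).b = -x.b := rfl
@[simp] theorem neg_p (x : OnePointExt k B P₀) : (-x).p = -x.p := rfl
@[simp] theorem neg_c (x : OnePointExt k B P₀) : (-x).c = -x.c := rfl
@[simp] theorem mul_b (x y : OnePointExt k B P₀) : (x * y).b = x.b * y.b := rfl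
@[simp] theorem mul_p (x y : OnePointExt k B P₀) : (x * y).p = x.b • y.p + y.c • x.p := rfl
@[simp] theorem mul_c (x y : OnePointExt k B P₀) : (x * y).c = x.c * y.c := rfl

variable [IsScalarTower k B P₀]

instance : Ring (OnePointExt k B P₀) where
  add_assoc x y z := by ext <;> simp [add_assoc]
  zero_add x := by ext <;> simp
  add_zero x := by ext <;> simp
  add_comm x y := by ext <;> simp [add_comm]
  neg_add_cancel x := by ext <;> simp
  left_distrib x y z := by
    ext
    · simp [mul_add]
    · simp only [mul_p, add_p, add_c, smul_add, add_smul]; abel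
    · simp [mul_add]
  right_distrib x y z := by
    ext
    · simp [add_mul]
    · simp only [mul_p, add_p, add_b, smul_add, add_smul]; abel
    · simp [add_mul]
  zero_mul x := by ext <;> simp
  mul_zero x := by ext <;> simp
  mul_assoc x y z := by
    have := IsScalarTower.to_smulCommClass (R := k) (A := B) (M := P₀)
    ext
    · simp [mul_assoc]
    · simp only [mul_p, mul_b, mul_c, smul_add, mul_smul]
      rw [smul_comm z.c x.b y.p, smul_comm z.c y.c x.p, add_assoc]
    · simp [mul_assoc]
  one_mul x := by ext <;> simp
  mul_one x := by ext <;> simp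
  nsmul := nsmulRec
  zsmul := zsmulRec

instance : Algebra k (OnePointExt k B P₀) where
  smul r x := ⟨r • x.b, r • x.p, r • x.c⟩
  algebraMap :=
    { toFun := fun r => ⟨algebraMap k B r, 0, r⟩
      map_one' := by ext <;> simp
      map_mul' := fun r s => by ext <;> simp
      map_zero' := by ext <;> simp
      map_add' := fun r s => by ext <;> simp }
  commutes' r x := by
    ext
    · exact Algebra.commutes r x.b
    · simp
    · exact mul_comm _ _
  smul_def' r x := by
    ext
    · exact Algebra.smul_def r x.b
    · change r • x.p = algebraMap k B r • x.p + x.c • (0 : P₀)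
      simp
    · rfl

end Algebra

section Restriction

variable (k B P₀ : Type u) [Field k] [Ring B] [Algebra k B] [AddCommGroup P₀] [Module B P₀]
  [Module k P₀] [IsScalarTower k B P₀]

/-- The idempotent `e_B`, the identity of `B` seen in the one-point extension. -/
def eB : OnePointExt k B P₀ := ⟨1, 0, 0⟩

variable {B} in
/-- The element of the one-point extension given by `b : B` in the upper left corner. -/
def ofB (b : B) : OnePointExt k B P₀ := ⟨b, 0, 0⟩

/-- The left ideal `A e_B` of the one-point extension `A`. -/
def AeB : Submodule (OnePointExt k B P₀) (OnePointExt k B P₀) :=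
  Submodule.span (OnePointExt k B P₀) {eB k B P₀}

variable {k B P₀}

theorem ofB_mul_eB (b : B) : ofB k P₀ b * eB k B P₀ = ofB k P₀ b := by
  ext <;> simp [ofB, eB]

theorem mul_eB_of_mem {x : OnePointExt k B P₀} (hx : x ∈ AeB k B P₀) : x * eB k B P₀ = x := by
  obtain ⟨a, rfl⟩ := Submodule.mem_span_singleton.1 hx
  rw [smul_eq_mul, mul_assoc]
  congr 1
  ext <;> simp [eB]

theorem mul_ofB_mem (x : OnePointExt k B P₀) (b : B) : x * ofB k P₀ b ∈ AeB k B P₀ :=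
  Submodule.mem_span_singleton.2
    ⟨x * ofB k P₀ b, by rw [smul_eq_mul, mul_assoc, ofB_mul_eB]⟩

/-- Right multiplication by `b : B` on `A e_B`. -/
def rightMul (b : B) : AeB k B P₀ →ₗ[OnePointExt k B P₀] AeB k B P₀ where
  toFun x := ⟨x.1 * ofB k P₀ b, mul_ofB_mem _ _⟩
  map_add' _ _ := Subtype.ext (add_mul _ _ _)
  map_smul' _ _ := Subtype.ext (mul_assoc _ _ _)

theorem rightMul_one : rightMul (k := k) (P₀ := P₀) (1 : B) = LinearMap.id :=
  LinearMap.ext fun x => Subtype.ext (mul_eB_of_mem x.2)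

theorem rightMul_zero : rightMul (k := k) (P₀ := P₀) (0 : B) = 0 :=
  LinearMap.ext fun x => Subtype.ext (mul_zero x.1)

theorem rightMul_add (b b' : B) :
    rightMul (k := k) (P₀ := P₀) (b + b') = rightMul b + rightMul b' :=
  LinearMap.ext fun x => Subtype.ext <| by
    change x.1 * ofB k P₀ (b + b') = x.1 * ofB k P₀ b + x.1 * ofB k P₀ b'
    rw [← mul_add]
    congr 1
    ext <;> simp [ofB]

theorem rightMul_mul (b b' : B) :
    rightMul (k := k) (P₀ := P₀) (b * b') = (rightMul b').comp (rightMul b) :=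
  LinearMap.ext fun x => Subtype.ext <| by
    change x.1 * ofB k P₀ (b * b') = x.1 * ofB k P₀ b * ofB k P₀ b'
    rw [mul_assoc]
    congr 1
    ext <;> simp [ofB]

/-- `Hom_A(A e_B, X)` as a left `B`-module: `(b • f)(x) = f (x b)`. -/
instance homModule (X : Type u) [AddCommGroup X] [Module (OnePointExt k B P₀) X] :
    Module B (AeB k B P₀ →ₗ[OnePointExt k B P₀] X) where
  smul b f := f.comp (rightMul b)
  one_smul f := by
    change f.comp (rightMul 1) = f
    rw [rightMul_one, LinearMap.comp_id]
  mul_smul b b' f := by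
    change f.comp (rightMul (b * b')) = (f.comp (rightMul b')).comp (rightMul b)
    rw [rightMul_mul, LinearMap.comp_assoc]
  smul_zero b := LinearMap.zero_comp _
  smul_add b f g := LinearMap.add_comp _ _ _
  add_smul b b' f := by
    change f.comp (rightMul (b + b')) = f.comp (rightMul b) + f.comp (rightMul b')
    rw [rightMul_add, LinearMap.comp_add]
  zero_smul f := by
    change f.comp (rightMul 0) = 0
    rw [rightMul_zero, LinearMap.comp_zero]

variable (k B P₀)

/-- The restriction functor `ℛ = Hom_A(A e_B, -) : Mod A ⥤ Mod B` for `A = B[P₀]`. -/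
def restriction : ModuleCat.{u} (OnePointExt k B P₀) ⥤ ModuleCat.{u} B where
  obj X := ModuleCat.of B (AeB k B P₀ →ₗ[OnePointExt k B P₀] X)
  map {X Y} φ := ModuleCat.ofHom
    (X := AeB k B P₀ →ₗ[OnePointExt k B P₀] X) (Y := AeB k B P₀ →ₗ[OnePointExt k B P₀] Y)
    { toFun := fun f => φ.hom.comp f
      map_add' := fun f g => LinearMap.comp_add _ _ _
      map_smul' := fun _ _ => rfl }

/-- The projection of the one-point extension onto its lower right entry. -/
def projK : OnePointExt k B P₀ →+* k where
  toFun x := x.c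
  map_one' := rfl
  map_mul' _ _ := rfl
  map_zero' := rfl
  map_add' _ _ := rfl

/-- The simple injective `A`-module `S`: the field `k`, on which `A` acts through the lower right
entry. -/
noncomputable def simpleS : ModuleCat.{u} (OnePointExt k B P₀) :=
  (ModuleCat.restrictScalars (projK k B P₀)).obj (ModuleCat.of k k)

/-- The right perpendicular category of `S`: all `X` with `Hom_A(S, X) = 0` and
`Ext¹_A(S, X) = 0`. -/
def sPerp : ObjectProperty (ModuleCat.{u} (OnePointExt k B P₀)) := fun X =>
  (∀ f : simpleS k B P₀ ⟶ X, f = 0) ∧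
    ∀ e : Abelian.Ext.{u} (simpleS k B P₀) X 1, e = 0

end Restriction

end OnePointExt

/-! Restriction R lies in an adjoint triple E ⊣ R ⊣ G. Here E is inflation along A → B and G sends Y
to (Y, Hom_B(P₀, Y)). Both E and G are fully faithful, E is exact, and G preserves epimorphisms
because P₀ is projective. The modules killed by R are those on which A acts through k, and all of
them are injective.

The unit X → GRX is inverted by R, so its kernel and cokernel are injective: it is a split
epimorphism onto its image, followed by a monomorphism with injective cokernel. Hence Ext¹(C, X) = 0
forces Ext¹(C, GRX) = 0, that is, Ext¹(RC, RX) = 0. Together with Ext¹(EY, X) = 0 ⇔ Ext¹(Y, RX) = 0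
this gives ^{⊥₁}(R𝒯) = R𝒞 (`leftPerpOne_map_eq`). Applying R to the torsion sequence of GY gives a
torsion pair (`isTorsionPair_map`), and approximations move along the two adjunctions. A Wakamatsu
argument (`kernel_mem_of_isRightApproximation`) passes from R(𝒞 ∩ 𝒯) to R𝒞 ∩ R𝒯, which could a
priori be larger.

Objects of 𝒯 are quotients of objects of 𝒞 ∩ 𝒯, so Fac(R(𝒞 ∩ 𝒯)) = R𝒯 and both triples are the
transported one. The torsion-free classes agree because GY lies in S^perp and the unit is epi on
S^perp (`rightOrthogonal_map_eq`). -/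

namespace TauCot

/-! ### Vanishing of Ext¹ -/

section Ext

variable {𝒜 : Type u} [Category.{v} 𝒜] [Abelian 𝒜] [HasExt.{w} 𝒜]

/-- Vanishing of `Ext¹` passes to retracts in both variables. -/
theorem ext_eq_zero_of_retract {M M' X X' : 𝒜} (r : Retract M' M) (s : Retract X' X)
    (h : ∀ e : Abelian.Ext.{w} M X 1, e = 0) (e : Abelian.Ext.{w} M' X' 1) : e = 0 := by
  have h1 := h (((Abelian.Ext.mk₀ r.r).comp e (zero_add 1)).comp
    (Abelian.Ext.mk₀ s.i) (add_zero 1))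
  have h2 : ((Abelian.Ext.mk₀ r.i).comp ((((Abelian.Ext.mk₀ r.r).comp e (zero_add 1)).comp
      (Abelian.Ext.mk₀ s.i) (add_zero 1)).comp (Abelian.Ext.mk₀ s.r) (add_zero 1))
      (zero_add 1)) = e := by
    rw [Abelian.Ext.comp_assoc_of_third_deg_zero, Abelian.Ext.mk₀_comp_mk₀, s.retract,
      Abelian.Ext.comp_mk₀_id, Abelian.Ext.mk₀_comp_mk₀_assoc, r.retract, Abelian.Ext.mk₀_id_comp]
  rw [← h2, h1, Abelian.Ext.zero_comp, Abelian.Ext.comp_zero]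

/-- If `Ext¹(M, Y) = 0`, morphisms to `Y` extend along monomorphisms with cokernel `M`. -/
theorem exists_extension {S : ShortComplex 𝒜} (hS : S.ShortExact) {Y : 𝒜}
    (h : ∀ e : Abelian.Ext.{w} S.X₃ Y 1, e = 0) (f : S.X₁ ⟶ Y) : ∃ g : S.X₂ ⟶ Y, S.f ≫ g = f := by
  obtain ⟨x, hx⟩ := Abelian.Ext.contravariant_sequence_exact₁ hS Y (Abelian.Ext.mk₀ f)
    (add_zero 1) (h _)
  obtain ⟨g, rfl⟩ := Abelian.Ext.mk₀_bijective _ _ |>.2 x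
  rw [Abelian.Ext.mk₀_comp_mk₀] at hx
  exact ⟨g, (Abelian.Ext.mk₀_bijective _ _).1 hx⟩

/-- If `Ext¹(M, X₁) = 0`, morphisms from `M` lift along epimorphisms with kernel `X₁`. -/
theorem exists_lift {S : ShortComplex 𝒜} (hS : S.ShortExact) {M : 𝒜}
    (h : ∀ e : Abelian.Ext.{w} M S.X₁ 1, e = 0) (f : M ⟶ S.X₃) : ∃ g : M ⟶ S.X₂, g ≫ S.g = f := by
  obtain ⟨x, hx⟩ := Abelian.Ext.covariant_sequence_exact₃ M hS (Abelian.Ext.mk₀ f)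
    (zero_add 1) (h _)
  obtain ⟨g, rfl⟩ := Abelian.Ext.mk₀_bijective _ _ |>.2 x
  rw [Abelian.Ext.mk₀_comp_mk₀] at hx
  exact ⟨g, (Abelian.Ext.mk₀_bijective _ _).1 hx⟩

/-- `Ext¹` computed by a projective presentation. -/
theorem ext_eq_zero_iff {S : ShortComplex 𝒜} (hS : S.ShortExact) [Projective S.X₂] {Y : 𝒜} :
    (∀ e : Abelian.Ext.{w} S.X₃ Y 1, e = 0) ↔ ∀ f : S.X₁ ⟶ Y, ∃ g : S.X₂ ⟶ Y, S.f ≫ g = f := by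
  refine ⟨fun h f => exists_extension hS h f, fun h e => ?_⟩
  obtain ⟨x, rfl⟩ := Abelian.Ext.contravariant_sequence_exact₃ hS Y e
    (Abelian.Ext.eq_zero_of_projective _) (add_zero 1)
  obtain ⟨f, rfl⟩ := Abelian.Ext.mk₀_bijective _ _ |>.2 x
  obtain ⟨g, rfl⟩ := h f
  rw [← Abelian.Ext.mk₀_comp_mk₀]
  exact hS.extClass_comp_assoc _

/-- `Ext¹(M, -)` of the middle term of a short exact sequence whose last term is injective. -/
theorem ext_eq_zero_of_injective {S : ShortComplex 𝒜} (hS : S.ShortExact) [Injective S.X₃] {M : 𝒜}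
    (h : ∀ e : Abelian.Ext.{w} M S.X₁ 1, e = 0) (e : Abelian.Ext.{w} M S.X₂ 1) : e = 0 := by
  obtain ⟨x, rfl⟩ := Abelian.Ext.covariant_sequence_exact₂ M hS e
    (Abelian.Ext.eq_zero_of_injective _)
  rw [h x, Abelian.Ext.zero_comp]

omit [HasExt.{w} 𝒜] in
theorem shortExact_kernel {X Y : 𝒜} (f : X ⟶ Y) [Epi f] :
    (ShortComplex.mk (kernel.ι f) f (kernel.condition f)).ShortExact where
  exact := ShortComplex.exact_kernel f
  mono_f := inferInstanceAs (Mono (kernel.ι f))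
  epi_g := ‹Epi f›

omit [HasExt.{w} 𝒜] in
theorem shortExact_cokernel {X Y : 𝒜} (f : X ⟶ Y) [Mono f] :
    (ShortComplex.mk f (cokernel.π f) (cokernel.condition f)).ShortExact where
  exact := ShortComplex.exact_cokernel f
  mono_f := ‹Mono f›
  epi_g := inferInstanceAs (Epi (cokernel.π f))

/-- `Ext¹(F M, X) = 0` if and only if `Ext¹(M, U X) = 0`, for an adjunction `F ⊣ U` with
`F` exact and preserving projectives. -/
theorem ext_eq_zero_iff_of_adjunction {ℬ : Type*} [Category* ℬ] [Abelian ℬ]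
    [HasExt.{w} ℬ] [EnoughProjectives 𝒜] {F : 𝒜 ⥤ ℬ} {U : ℬ ⥤ 𝒜} (adj : F ⊣ U)
    [F.PreservesZeroMorphisms] [PreservesFiniteLimits F] [PreservesFiniteColimits F]
    [U.PreservesEpimorphisms] (M : 𝒜) (X : ℬ) :
    (∀ e : Abelian.Ext.{w} (F.obj M) X 1, e = 0) ↔
      ∀ e : Abelian.Ext.{w} M (U.obj X) 1, e = 0 := by
  have hS := shortExact_kernel (Projective.π M)
  -- The image under F is a projective presentation of F M, so both vanishing conditions become
  -- extension problems, matched by the adjunction.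
  have hS' := hS.map_of_exact F
  have : Projective ((ShortComplex.mk _ _ (kernel.condition (Projective.π M))).map F).X₂ :=
    adj.map_projective _ (Projective.projective_over M)
  have : Projective (ShortComplex.mk _ _ (kernel.condition (Projective.π M))).X₂ :=
    Projective.projective_over M
  refine (ext_eq_zero_iff hS').trans (Iff.trans ?_ (ext_eq_zero_iff hS).symm)
  constructor
  · intro h (f : kernel (Projective.π M) ⟶ U.obj X)
    obtain ⟨(g : F.obj (Projective.over M) ⟶ X),
        (hg : F.map (kernel.ι (Projective.π M)) ≫ g = _)⟩ := h ((adj.homEquiv _ _).symm f)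
    refine ⟨adj.homEquiv _ _ g, ?_⟩
    change kernel.ι (Projective.π M) ≫ adj.homEquiv _ _ g = f
    rw [← adj.homEquiv_naturality_left, hg, Equiv.apply_symm_apply]
  · intro h (f : F.obj (kernel (Projective.π M)) ⟶ X)
    obtain ⟨(g : Projective.over M ⟶ U.obj X), (hg : kernel.ι (Projective.π M) ≫ g = _)⟩ :=
      h (adj.homEquiv _ _ f)
    refine ⟨(adj.homEquiv _ _).symm g, ?_⟩
    change F.map (kernel.ι (Projective.π M)) ≫ (adj.homEquiv _ _).symm g = f
    rw [← adj.homEquiv_naturality_left_symm, hg, Equiv.symm_apply_apply]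

instance (P : ObjectProperty 𝒜) : (leftPerpOne.{w} P).IsClosedUnderIsomorphisms where
  of_iso e h _ hX := ext_eq_zero_of_retract (Retract.ofIso e.symm) (Retract.refl _) (h hX)

end Ext

/-! ### Torsion pairs, up to isomorphism closure -/

section TorsionPair

variable {𝒜 : Type u} [Category.{v} 𝒜] [Abelian 𝒜] {𝒯 ℱ : ObjectProperty 𝒜}

/-- The classes are not assumed closed under isomorphism, so orthogonality recovers them only up to
isomorphism. -/
theorem IsTorsionPair.isoClosure_left (h : IsTorsionPair 𝒯 ℱ) {M : 𝒜}
    (hM : ∀ ⦃F : 𝒜⦄, ℱ F → ∀ f : M ⟶ F, f = 0) : 𝒯.isoClosure M := by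
  obtain ⟨T, F, i, p, zero, hT, hF, hS⟩ := h.exists_shortExact M
  obtain rfl := hM hF p
  have := hS.mono_f
  have : Epi i := hS.exact.epi_f rfl
  have := isIso_of_mono_of_epi i
  exact ⟨T, hT, ⟨(asIso i).symm⟩⟩

theorem IsTorsionPair.isoClosure_right (h : IsTorsionPair 𝒯 ℱ) {M : 𝒜}
    (hM : ∀ ⦃T : 𝒜⦄, 𝒯 T → ∀ f : T ⟶ M, f = 0) : ℱ.isoClosure M := by
  obtain ⟨T, F, i, p, zero, hT, hF, hS⟩ := h.exists_shortExact M
  obtain rfl := hM hT i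
  have := hS.epi_g
  have : Mono p := hS.exact.mono_g rfl
  have := isIso_of_mono_of_epi p
  exact ⟨F, hF, ⟨asIso p⟩⟩

theorem IsTorsionPair.isoClosure_of_epi (h : IsTorsionPair 𝒯 ℱ) {T M : 𝒜} (hT : 𝒯 T)
    (p : T ⟶ M) [Epi p] : 𝒯.isoClosure M :=
  h.isoClosure_left fun F hF f => by
    rw [← cancel_epi p, h.hom_eq_zero hT hF (p ≫ f), comp_zero]

end TorsionPair

/-! ### Building a τ-cotorsion pair from a subcategory ℳ of approximating objects -/

section Cotorsion

variable {𝒜 : Type u} [Category.{v} 𝒜] [Abelian 𝒜] [HasExt.{w} 𝒜] [EnoughProjectives 𝒜]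

/-- In a `τ`-cotorsion pair every object of `𝒟` is a quotient of an object of `𝒞 ⊓ 𝒟`. -/
theorem IsTauCotorsionPair.exists_epi {𝒞 𝒟 : ObjectProperty 𝒜} (h : IsTauCotorsionPair.{w} 𝒞 𝒟)
    {X : 𝒜} (hX : 𝒟 X) : ∃ (D : 𝒜) (p : D ⟶ X), (𝒞 ⊓ 𝒟) D ∧ Epi p := by
  obtain ⟨D, C, f, g, zero, hD, -, -, -, hf⟩ :=
    h.exists_exact (Projective.over X) (Projective.projective_over X)
  obtain ⟨p, hp⟩ := hf.2 (Projective.π X) hX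
  have : Epi (f ≫ p) := hp ▸ inferInstance
  exact ⟨D, p, hD, epi_of_epi f p⟩

variable {ℳ 𝒟 : ObjectProperty 𝒜} (h𝒟 : ∀ ⦃X Y : 𝒜⦄ (p : X ⟶ Y), Epi p → 𝒟 X → 𝒟 Y)
  (hℳ𝒟 : ℳ ≤ 𝒟) (hℳ : ℳ ≤ leftPerpOne.{w} 𝒟)
  (hproj : ∀ P : 𝒜, Projective P →
    ∃ (D C : 𝒜) (f : P ⟶ D) (g : D ⟶ C) (zero : f ≫ g = 0),
      ℳ D ∧ ℳ C ∧ (ShortComplex.mk f g zero).Exact ∧ Epi g ∧ IsLeftApproximation 𝒟 f)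

omit [HasExt.{w} 𝒜] in
include hproj in
theorem epi_of_isRightApproximation {X Y : 𝒜} {p : X ⟶ Y} (hp : IsRightApproximation ℳ p)
    (hY : 𝒟 Y) : Epi p := by
  obtain ⟨D, C, f, g, zero, hD, -, -, -, hf⟩ := hproj _ (Projective.projective_over Y)
  obtain ⟨q, hq⟩ := hf.2 (Projective.π Y) hY
  obtain ⟨r, hr⟩ := hp.2 q hD
  have : Epi ((f ≫ r) ≫ p) := by rw [Category.assoc, hr, hq]; infer_instance
  exact epi_of_epi (f ≫ r) p

include h𝒟 hℳ𝒟 hℳ hproj in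
/-- The kernel of a right `ℳ`-approximation of an object of `𝒟` is in `𝒟`. -/
theorem kernel_mem_of_isRightApproximation {X Y : 𝒜} {p : X ⟶ Y} (hp : IsRightApproximation ℳ p)
    (hY : 𝒟 Y) : 𝒟 (kernel p) := by
  have := epi_of_isRightApproximation hproj hp hY
  have hS := shortExact_kernel p
  -- Wakamatsu's lemma: as Ext¹(N, X) = 0, every class is the connecting image of some N ⟶ Y; this
  -- map lifts along the approximation p, so the class is zero.
  have hext : ∀ {N : 𝒜}, ℳ N → ∀ e : Abelian.Ext.{w} N (kernel p) 1, e = 0 := by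
    intro N hN e
    obtain ⟨x, rfl⟩ := Abelian.Ext.covariant_sequence_exact₁ N hS e
      (hℳ N hN (hℳ𝒟 _ hp.1) _) (zero_add 1)
    obtain ⟨a, rfl⟩ := Abelian.Ext.mk₀_bijective _ _ |>.2 x
    obtain ⟨b, rfl⟩ := hp.2 a hN
    rw [← Abelian.Ext.mk₀_comp_mk₀, Abelian.Ext.comp_assoc_of_second_deg_zero]
    have := hS.comp_extClass
    dsimp at this
    rw [this, Abelian.Ext.comp_zero]
  obtain ⟨D, C, f, g, zero, hD, hC, hfg, hg, hf⟩ :=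
    hproj _ (Projective.projective_over (kernel p))
  obtain ⟨q, hq⟩ := hf.2 (Projective.π (kernel p) ≫ kernel.ι p) (hℳ𝒟 _ hp.1)
  -- The map q sends ker g, the image of f, into ker p. Since Ext¹(C, ker p) = 0, this restriction
  -- extends to r : D ⟶ ker p. Then f ≫ r is the projective cover map, so ker p is a quotient of D.
  have hzero : kernel.ι g ≫ q ≫ p = 0 := by
    have : Epi (kernel.lift g f zero) := hfg.epi_kernelLift
    rw [← cancel_epi (kernel.lift g f zero), kernel.lift_ι_assoc, reassoc_of% hq,
      kernel.condition, comp_zero, comp_zero]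
  obtain ⟨r, hr⟩ := exists_extension (shortExact_kernel g) (hext hC)
    (kernel.lift p (kernel.ι g ≫ q) (by simpa using hzero))
  have hfr : f ≫ r = Projective.π (kernel p) := by
    dsimp at hr
    have : f ≫ r = kernel.lift g f zero ≫ kernel.ι g ≫ r := (kernel.lift_ι_assoc ..).symm
    rw [this, hr, ← cancel_mono (kernel.ι p), Category.assoc, kernel.lift_ι,
      kernel.lift_ι_assoc, hq]
  have : Epi (f ≫ r) := hfr ▸ inferInstance
  exact h𝒟 r (epi_of_epi f r) (hℳ𝒟 _ hD)

include h𝒟 hℳ𝒟 hℳ hproj in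
-- An object of ^{⊥₁}𝒟 ∩ 𝒟 is a retract of an object of ℳ: its ℳ-approximation is epi with kernel in
-- 𝒟, hence splits. So right ℳ-approximations also serve the larger class ^{⊥₁}𝒟 ∩ 𝒟.
theorem isTauCotorsionPair_leftPerpOne (hcf : IsContravariantlyFinite ℳ) :
    IsTauCotorsionPair.{w} (leftPerpOne.{w} 𝒟) 𝒟 where
  contravariantlyFinite Y := by
    obtain ⟨D, p, hp⟩ := hcf Y
    refine ⟨D, p, ⟨hℳ _ hp.1, hℳ𝒟 _ hp.1⟩, fun Y' g hY' => ?_⟩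
    obtain ⟨D', p', hp'⟩ := hcf Y'
    have := epi_of_isRightApproximation hproj hp' hY'.2
    have hker := kernel_mem_of_isRightApproximation h𝒟 hℳ𝒟 hℳ hproj hp' hY'.2
    obtain ⟨s, hs⟩ := exists_lift (shortExact_kernel p') (hY'.1 hker) (𝟙 Y')
    obtain ⟨r, hr⟩ := hp.2 (p' ≫ g) hp'.1
    refine ⟨s ≫ r, ?_⟩
    dsimp at hs
    rw [Category.assoc, hr, reassoc_of% hs]
  eq_leftPerpOne := rfl
  exists_exact P hP := by
    obtain ⟨D, C, f, g, zero, hD, hC, hfg, hg, hf⟩ := hproj P hP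
    exact ⟨D, C, f, g, zero, ⟨hℳ _ hD, hℳ𝒟 _ hD⟩, hℳ _ hC, hfg, hg, hf⟩

end Cotorsion

end TauCot

namespace TauCot

/-! ### Transport along R with R ⊣ G, G fully faithful and ker R consisting of injectives -/

section Localization

universe v' u'

variable {𝒜 : Type u} [Category.{v} 𝒜] [Abelian 𝒜]
  {ℬ : Type u'} [Category.{v'} ℬ] [Abelian ℬ]
  {R : 𝒜 ⥤ ℬ} {G : ℬ ⥤ 𝒜} (adj : R ⊣ G)
  [R.PreservesZeroMorphisms] [PreservesFiniteLimits R] [PreservesFiniteColimits R]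
  [IsIso adj.counit]
  (hinj : ∀ X : 𝒜, IsZero (R.obj X) → Injective X)

instance isIso_map_unit_app (X : 𝒜) : IsIso (R.map (adj.unit.app X)) := by
  have h := adj.left_triangle_components X
  rw [← IsIso.eq_comp_inv] at h
  rw [h, Category.id_comp]
  infer_instance

instance isIso_unit_app_obj (Y : ℬ) : IsIso (adj.unit.app (G.obj Y)) := by
  have h := adj.right_triangle_components Y
  rw [← IsIso.eq_comp_inv] at h
  rw [h, Category.id_comp]
  infer_instance

theorem isZero_obj_X₁ {S : ShortComplex 𝒜} (hS : S.ShortExact) [IsIso (R.map S.g)] :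
    IsZero (R.obj S.X₁) := by
  have h := hS.map_of_exact R
  have : Mono (R.map S.f) := h.mono_f
  have hz : R.map S.f = 0 := by
    rw [← cancel_mono (R.map S.g), ← R.map_comp, S.zero, R.map_zero, zero_comp]
  exact (IsZero.iff_id_eq_zero _).2 ((cancel_mono (R.map S.f)).1 (by rw [hz, comp_zero, comp_zero]))

theorem isZero_obj_X₃ {S : ShortComplex 𝒜} (hS : S.ShortExact) [IsIso (R.map S.f)] :
    IsZero (R.obj S.X₃) := by
  have h := hS.map_of_exact R
  have : Epi (R.map S.g) := h.epi_g
  have hz : R.map S.g = 0 := by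
    rw [← cancel_epi (R.map S.f), ← R.map_comp, S.zero, R.map_zero, comp_zero]
  exact (IsZero.iff_id_eq_zero _).2 ((cancel_epi (R.map S.g)).1 (by rw [hz, zero_comp, zero_comp]))

include hinj in
/-- An epimorphism inverted by `R` splits. -/
theorem exists_section {X Y : 𝒜} (f : X ⟶ Y) [Epi f] [IsIso (R.map f)] :
    ∃ s : Y ⟶ X, s ≫ f = 𝟙 Y := by
  have hS := shortExact_kernel f
  have : IsIso (R.map (ShortComplex.mk _ _ (kernel.condition f)).g) :=
    inferInstanceAs (IsIso (R.map f))
  have : Injective (ShortComplex.mk _ _ (kernel.condition f)).X₁ := hinj _ (isZero_obj_X₁ hS)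
  exact ⟨hS.splittingOfInjective.s, hS.splittingOfInjective.s_g⟩

instance isIso_map_factorThruImage {X Y : 𝒜} (f : X ⟶ Y) [IsIso (R.map f)] :
    IsIso (R.map (Abelian.factorThruImage f)) := by
  have h : R.map (Abelian.factorThruImage f) ≫ R.map (Abelian.image.ι f) = R.map f := by
    rw [← R.map_comp, Abelian.image.fac]
  have : Mono (R.map (Abelian.factorThruImage f) ≫ R.map (Abelian.image.ι f)) := by
    rw [h]; infer_instance
  have := mono_of_mono (R.map (Abelian.factorThruImage f)) (R.map (Abelian.image.ι f))
  exact isIso_of_mono_of_epi _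

instance isIso_map_image_ι {X Y : 𝒜} (f : X ⟶ Y) [IsIso (R.map f)] :
    IsIso (R.map (Abelian.image.ι f)) := by
  have h : R.map (Abelian.factorThruImage f) ≫ R.map (Abelian.image.ι f) = R.map f := by
    rw [← R.map_comp, Abelian.image.fac]
  rw [← IsIso.eq_inv_comp] at h
  rw [h]
  infer_instance

include hinj in
/-- If `Ext¹(C, X) = 0` then `Ext¹(C, Y) = 0` for every morphism `X ⟶ Y` inverted by `R`. -/
theorem ext_eq_zero_of_isIso_map [HasExt.{w} 𝒜] {C X Y : 𝒜} (f : X ⟶ Y) [IsIso (R.map f)]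
    (h : ∀ e : Abelian.Ext.{w} C X 1, e = 0) (e : Abelian.Ext.{w} C Y 1) : e = 0 := by
  -- The image of f is a retract of X, and its inclusion into Y has a cokernel killed by R, hence
  -- injective.
  obtain ⟨s, hs⟩ := exists_section hinj (Abelian.factorThruImage f)
  have h' := ext_eq_zero_of_retract (Retract.refl C) ⟨s, _, hs⟩ h
  have hS := shortExact_cokernel (Abelian.image.ι f)
  have : IsIso (R.map (ShortComplex.mk _ _ (cokernel.condition (Abelian.image.ι f))).f) :=
    inferInstanceAs (IsIso (R.map (Abelian.image.ι f)))
  have : Injective (ShortComplex.mk _ _ (cokernel.condition (Abelian.image.ι f))).X₃ :=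
    hinj _ (isZero_obj_X₃ hS)
  exact ext_eq_zero_of_injective hS h' e

/-- By naturality p followed by the unit at N is the isomorphism at G Y followed by G(R p), which is
epi. -/
theorem epi_unit_app_of_epi [G.PreservesEpimorphisms] {Y : ℬ} {N : 𝒜} (p : G.obj Y ⟶ N) [Epi p] :
    Epi (adj.unit.app N) := by
  have h := adj.unit.naturality p
  dsimp at h
  have : Epi (p ≫ adj.unit.app N) := by rw [h]; infer_instance
  exact epi_of_epi p _

include hinj in
/-- If the unit at `N` is epi and `Hom(X, N) = 0`, then `Hom(R X, R N) = 0`. -/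
theorem map_hom_eq_zero {X N : 𝒜} [Epi (adj.unit.app N)] (h : ∀ f : X ⟶ N, f = 0)
    (f : R.obj X ⟶ R.obj N) : f = 0 := by
  obtain ⟨s, hs⟩ := exists_section hinj (adj.unit.app N)
  -- The transpose X ⟶ G R N equals itself followed by s and the unit, and already its composite
  -- with s is a map X ⟶ N.
  have h0 : adj.homEquiv _ _ f = 0 := by
    rw [← Category.comp_id (adj.homEquiv _ _ f)]
    change _ ≫ 𝟙 ((R ⋙ G).obj N) = 0
    rw [← hs, ← Category.assoc, h (adj.homEquiv _ _ f ≫ s), zero_comp]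
  have := congrArg (fun g => R.map g ≫ adj.counit.app _) h0
  simpa [Adjunction.homEquiv_unit] using this

variable {𝒞 𝒯 ℱ : ObjectProperty 𝒜}

include adj hinj in
-- The sequence for Y is R applied to that of G Y, using R G Y ≅ Y. Its torsion-free term F is a
-- quotient of G Y, so the unit at F is epi and Hom(X, F) = 0 descends to Hom(R X, R F) = 0.
theorem isTorsionPair_map [G.PreservesEpimorphisms] (h : IsTorsionPair 𝒯 ℱ)
    (hepi : ∀ ⦃X : 𝒜⦄, 𝒯 X → ∃ (D : 𝒜) (p : D ⟶ X), (𝒞 ⊓ 𝒯) D ∧ Epi p) :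
    IsTorsionPair (𝒯.map R) ((𝒞 ⊓ 𝒯).map R).rightOrthogonal where
  hom_eq_zero := by
    rintro T F ⟨X, hX, ⟨e⟩⟩ hF f
    obtain ⟨D, p, hD, hp⟩ := hepi hX
    rw [← cancel_epi (R.map p ≫ e.hom), comp_zero]
    exact hF _ (ObjectProperty.prop_map_obj _ _ hD)
  exists_shortExact Y := by
    obtain ⟨T, F, i, p, zero, hT, hF, hS⟩ := h.exists_shortExact (G.obj Y)
    have := hS.epi_g
    dsimp at this
    have hu := epi_unit_app_of_epi adj p
    refine ⟨R.obj T, R.obj F, R.map i ≫ adj.counit.app Y, inv (adj.counit.app Y) ≫ R.map p,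
      by simp [← R.map_comp, zero], ObjectProperty.prop_map_obj _ _ hT, ?_, ?_⟩
    · rintro Z f ⟨X, hX, ⟨e⟩⟩
      rw [← cancel_epi e.hom, comp_zero]
      exact map_hom_eq_zero adj hinj (fun g => h.hom_eq_zero hX.2 hF g) _
    · refine ShortComplex.shortExact_of_iso ?_ (hS.map_of_exact R)
      have : IsIso (adj.counit.app Y) := inferInstance
      exact ShortComplex.isoMk (Iso.refl _) (@asIso _ _ _ _ (adj.counit.app Y) this) (Iso.refl _)
        (Category.id_comp _)
        ((IsIso.hom_inv_id_assoc (adj.counit.app Y) _).trans (Category.comp_id _).symm)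

attribute [local instance] Abelian.hasFiniteBiproducts in
omit [PreservesFiniteLimits R] [PreservesFiniteColimits R] [IsIso adj.counit]
  [R.PreservesZeroMorphisms] in
-- A torsion class closed under isomorphisms is closed under finite sums, summands and quotients, as
-- all these are tested by maps to torsion-free objects.
theorem fac_eq {𝒬 𝒯' ℱ' : ObjectProperty ℬ} [𝒯'.IsClosedUnderIsomorphisms]
    (h : IsTorsionPair 𝒯' ℱ') (hle : 𝒬 ≤ 𝒯')
    (hepi : ∀ ⦃Y : ℬ⦄, 𝒯' Y → ∃ (D : ℬ) (p : D ⟶ Y), 𝒬 D ∧ Epi p) : Fac 𝒬 = 𝒯' := by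
  ext Y
  constructor
  · rintro ⟨Z, p, ⟨n, X, hX, ⟨r⟩⟩, hp⟩
    rw [← 𝒯'.isoClosure_eq_self]
    refine h.isoClosure_left fun F hF f => ?_
    have h0 : r.r ≫ p ≫ f = 0 :=
      biproduct.hom_ext' _ _ fun j => by
        rw [comp_zero]
        exact h.hom_eq_zero (hle _ (hX j)) hF _
    rw [← cancel_epi p, comp_zero, ← Category.id_comp (p ≫ f), ← r.retract, Category.assoc, h0,
      comp_zero]
  · intro hY
    obtain ⟨D, p, hD, hp⟩ := hepi hY
    exact ⟨D, p, ⟨1, fun _ => D, fun _ => hD,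
      ⟨⟨biproduct.ι (fun _ : Fin 1 => D) 0, biproduct.π (fun _ : Fin 1 => D) 0, by simp⟩⟩⟩, hp⟩

omit [Abelian 𝒜] [Abelian ℬ] [R.PreservesZeroMorphisms] [PreservesFiniteLimits R] in
theorem exists_epi_map (hepi : ∀ ⦃X : 𝒜⦄, 𝒯 X → ∃ (D : 𝒜) (p : D ⟶ X), (𝒞 ⊓ 𝒯) D ∧ Epi p)
    ⦃Y : ℬ⦄ (hY : 𝒯.map R Y) : ∃ (D : ℬ) (p : D ⟶ Y), (𝒞 ⊓ 𝒯).map R D ∧ Epi p := by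
  obtain ⟨X, hX, ⟨e⟩⟩ := hY
  obtain ⟨D, p, hD, hp⟩ := hepi hX
  exact ⟨R.obj D, R.map p ≫ e.hom, ObjectProperty.prop_map_obj _ _ hD, inferInstance⟩

include adj hinj in
-- One inclusion uses Y ≅ R E Y and transfers Ext¹ along E ⊣ R; the other transfers along R ⊣ G and
-- replaces X by G R X, since the unit is inverted by R.
theorem leftPerpOne_map_eq [HasExt.{w} 𝒜] [HasExt.{w} ℬ] [EnoughProjectives 𝒜]
    [EnoughProjectives ℬ] [G.PreservesEpimorphisms] {E : ℬ ⥤ 𝒜} (adj' : E ⊣ R)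
    [E.PreservesZeroMorphisms] [PreservesFiniteLimits E] [PreservesFiniteColimits E]
    [IsIso adj'.unit] : leftPerpOne.{w} (𝒯.map R) = (leftPerpOne.{w} 𝒯).map R := by
  ext Y
  constructor
  · intro hY
    refine ⟨E.obj Y, fun X hX => ?_, ⟨(asIso (adj'.unit.app Y)).symm⟩⟩
    exact (ext_eq_zero_iff_of_adjunction adj' Y X).2 (hY (ObjectProperty.prop_map_obj _ _ hX))
  · rintro ⟨C, hC, ⟨e⟩⟩ Z ⟨X, hX, ⟨e'⟩⟩
    refine ext_eq_zero_of_retract (Retract.ofIso e.symm) (Retract.ofIso e'.symm) ?_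
    exact (ext_eq_zero_iff_of_adjunction adj C (R.obj X)).2
      (ext_eq_zero_of_isIso_map hinj (adj.unit.app X) (hC hX))

include adj hinj in
/-- Transport of `τ`-cotorsion torsion triples along a functor `R` in an adjoint triple
`E ⊣ R ⊣ G` of exact functors, whose outer terms are fully faithful, and such that the objects
in the kernel of `R` are injective. -/
theorem IsTauCotorsionTorsionTriple.map [HasExt.{w} 𝒜] [HasExt.{w} ℬ] [EnoughProjectives 𝒜]
    [EnoughProjectives ℬ] [G.PreservesEpimorphisms] {E : ℬ ⥤ 𝒜} (adj' : E ⊣ R)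
    [E.PreservesZeroMorphisms] [PreservesFiniteLimits E] [PreservesFiniteColimits E]
    [IsIso adj'.unit] (h : IsTauCotorsionTorsionTriple.{w} 𝒞 𝒯 ℱ) :
    IsTauCotorsionTorsionTriple.{w} (𝒞.map R) (𝒯.map R) ((𝒞 ⊓ 𝒯).map R).rightOrthogonal := by
  have htor := isTorsionPair_map adj hinj h.torsionPair fun X hX => h.tauCotorsionPair.exists_epi hX
  have h𝒞 : leftPerpOne.{w} (𝒯.map R) = 𝒞.map R := by
    rw [leftPerpOne_map_eq adj hinj adj', ← h.tauCotorsionPair.eq_leftPerpOne]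
  refine ⟨?_, htor⟩
  rw [← h𝒞]
  refine isTauCotorsionPair_leftPerpOne (ℳ := (𝒞 ⊓ 𝒯).map R) ?_
    (ObjectProperty.map_monotone inf_le_right R) ?_ ?_ ?_
  · intro X Y p hp hX
    rw [← (𝒯.map R).isoClosure_eq_self]
    exact htor.isoClosure_of_epi hX p
  · rw [h𝒞]
    exact ObjectProperty.map_monotone inf_le_left R
  · intro P hP
    -- E P is projective because R preserves epimorphisms; applying R to its sequence and using R E
    -- P ≅ P gives the sequence for P.
    obtain ⟨D, C, f, g, zero, hD, hC, hfg, hg, hf⟩ :=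
      h.tauCotorsionPair.exists_exact (E.obj P) (adj'.map_projective P hP)
    refine ⟨R.obj D, R.obj C, adj'.unit.app P ≫ R.map f, R.map g, by simp [← R.map_comp, zero],
      ObjectProperty.prop_map_obj _ _ hD, ?_, ?_, inferInstance,
      ObjectProperty.prop_map_obj _ _ hD.2, ?_⟩
    · obtain ⟨C', hC', ⟨e⟩⟩ := h.torsionPair.isoClosure_of_epi hD.2 g
      refine ⟨C', ⟨?_, hC'⟩, ⟨R.mapIso e.symm⟩⟩
      rw [h.tauCotorsionPair.eq_leftPerpOne] at hC ⊢
      exact ObjectProperty.prop_of_iso _ e hC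
    · refine ShortComplex.exact_of_iso ?_ (hfg.map R)
      exact ShortComplex.isoMk (asIso (adj'.unit.app P)).symm (Iso.refl _) (Iso.refl _)
        ((IsIso.inv_hom_id_assoc (adj'.unit.app P) _).trans (Category.comp_id _).symm)
        ((Category.id_comp _).trans (Category.comp_id _).symm)
    · rintro Z q ⟨X, hX, ⟨e⟩⟩
      obtain ⟨r, hr⟩ := hf.2 ((adj'.homEquiv _ _).symm (q ≫ e.inv)) hX
      refine ⟨R.map r ≫ e.hom, ?_⟩
      have := congrArg (adj'.homEquiv _ _) hr
      rw [Equiv.apply_symm_apply, Adjunction.homEquiv_unit, R.map_comp] at this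
      rw [Category.assoc, ← Category.assoc (R.map f), ← Category.assoc, this, Category.assoc,
        e.inv_hom_id, Category.comp_id]
  · intro Y
    obtain ⟨X, f, hX, hf⟩ := h.tauCotorsionPair.contravariantlyFinite (G.obj Y)
    refine ⟨R.obj X, (adj.homEquiv _ _).symm f, ObjectProperty.prop_map_obj _ _ hX, ?_⟩
    rintro Z q ⟨X', hX', ⟨e⟩⟩
    obtain ⟨r, hr⟩ := hf (adj.homEquiv _ _ (e.hom ≫ q)) hX'
    refine ⟨e.inv ≫ R.map r, ?_⟩
    rw [Category.assoc, ← adj.homEquiv_naturality_left_symm, hr, Equiv.symm_apply_apply,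
      e.inv_hom_id_assoc]

/-- The unit at `X` is epi when `X` is in the right perpendicular category of an object that detects
the kernel of `R`. -/
theorem epi_unit_app_of_perp [HasExt.{w} 𝒜] {S : 𝒜} (hS : IsZero (R.obj S))
    (hgen : ∀ N : 𝒜, IsZero (R.obj N) → (∀ f : S ⟶ N, f = 0) → IsZero N)
    (hinj : ∀ X : 𝒜, IsZero (R.obj X) → Injective X) {X : 𝒜}
    (hX : ∀ e : Abelian.Ext.{w} S X 1, e = 0) : Epi (adj.unit.app X) := by
  obtain ⟨s, hs⟩ := exists_section hinj (Abelian.factorThruImage (adj.unit.app X))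
  have h' := ext_eq_zero_of_retract (Retract.refl S) ⟨s, _, hs⟩ hX
  have hE := shortExact_cokernel (Abelian.image.ι (adj.unit.app X))
  have : IsIso (R.map (ShortComplex.mk _ _
      (cokernel.condition (Abelian.image.ι (adj.unit.app X)))).f) :=
    inferInstanceAs (IsIso (R.map (Abelian.image.ι (adj.unit.app X))))
  have hz : IsZero (cokernel (Abelian.image.ι (adj.unit.app X))) := by
    refine hgen _ (isZero_obj_X₃ hE) fun f => ?_
    -- A map from S to the cokernel lifts to G R X, where it is zero because its transpose starts at
    -- R S = 0.
    obtain ⟨g, rfl⟩ := exists_lift hE h' f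
    have : g = 0 := (adj.homEquiv _ _).symm.injective (hS.eq_of_src _ _)
    rw [this, zero_comp]
  have : Epi (Abelian.image.ι (adj.unit.app X)) :=
    Preadditive.epi_of_cokernel_zero (hz.eq_of_tgt _ _)
  rw [← Abelian.image.fac (adj.unit.app X)]
  infer_instance

include adj hinj in
-- If Y is orthogonal to R(𝒞 ∩ 𝒯), then G Y is in ℱ by adjunction and in S^perp because R S = 0, and
-- Y ≅ R G Y. Conversely the unit is epi on S^perp, so `map_hom_eq_zero` applies.
theorem rightOrthogonal_map_eq [HasExt.{w} 𝒜] [HasExt.{w} ℬ] [EnoughProjectives 𝒜]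
    [G.PreservesEpimorphisms] {S : 𝒜} (hS : IsZero (R.obj S))
    (hgen : ∀ N : 𝒜, IsZero (R.obj N) → (∀ f : S ⟶ N, f = 0) → IsZero N)
    (h : IsTauCotorsionTorsionTriple.{w} 𝒞 𝒯 ℱ) (𝒮 : ObjectProperty 𝒜)
    (h𝒮 : ∀ X, 𝒮 X ↔ (∀ f : S ⟶ X, f = 0) ∧ ∀ e : Abelian.Ext.{w} S X 1, e = 0) :
    ((𝒞 ⊓ 𝒯).map R).rightOrthogonal = (ℱ ⊓ 𝒮).map R := by
  ext Y
  constructor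
  · intro hY
    obtain ⟨F, hF, ⟨e⟩⟩ : ℱ.isoClosure (G.obj Y) := by
      refine h.torsionPair.isoClosure_right fun T hT f => ?_
      obtain ⟨D, p, hD, hp⟩ := h.tauCotorsionPair.exists_epi hT
      rw [← cancel_epi p, comp_zero]
      refine (adj.homEquiv _ _).symm.injective ?_
      exact (hY _ (ObjectProperty.prop_map_obj _ _ hD)).trans
        (hY _ (ObjectProperty.prop_map_obj _ _ hD)).symm
    refine ⟨F, ⟨hF, (h𝒮 F).2 ⟨fun f => ?_, ?_⟩⟩, ⟨R.mapIso e.symm ≪≫ asIso (adj.counit.app Y)⟩⟩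
    · rw [← cancel_mono e.inv]
      exact (adj.homEquiv _ _).symm.injective (hS.eq_of_src _ _)
    · refine ext_eq_zero_of_retract (Retract.refl S) (Retract.ofIso e.symm) ?_
      refine (ext_eq_zero_iff_of_adjunction adj S Y).1 fun x => ?_
      rw [← Abelian.Ext.mk₀_id_comp x, hS.eq_of_src (𝟙 _) 0, Abelian.Ext.mk₀_zero,
        Abelian.Ext.zero_comp]
  · rintro ⟨X, ⟨hF, hX⟩, ⟨e⟩⟩ Z f ⟨D, hD, ⟨e'⟩⟩
    have := epi_unit_app_of_perp adj hS hgen hinj ((h𝒮 X).1 hX).2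
    rw [← cancel_epi e'.hom, ← cancel_mono e.inv, comp_zero, zero_comp]
    exact map_hom_eq_zero adj hinj (fun g => h.torsionPair.hom_eq_zero hD.2 hF g) _

end Localization

end TauCot

namespace OnePointExt

/-! ### Matrix entries of the one-point extension -/

section Corner

variable {k B P₀ : Type u} [Field k] [Ring B] [AddCommGroup P₀]

/-- The element of the one-point extension given by `p : P₀` in the upper right corner. -/
def corner (k B : Type u) {P₀ : Type u} [Field k] [Ring B] (p : P₀) : OnePointExt k B P₀ :=
  ⟨0, p, 0⟩

/-- The element of the one-point extension given by `c : k` in the lower right corner. -/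
def ofK (B P₀ : Type u) {k : Type u} [Ring B] [AddCommGroup P₀] (c : k) : OnePointExt k B P₀ :=
  ⟨0, 0, c⟩

theorem corner_add (p q : P₀) : corner k B (p + q) = corner k B p + corner k B q := by
  ext <;> simp [corner]

theorem eB_add_ofK : eB k B P₀ + ofK B P₀ (1 : k) = 1 := by
  ext <;> simp [eB, ofK]

theorem ofK_add (c d : k) : ofK B P₀ (c + d) = ofK B P₀ c + ofK B P₀ d := by
  ext <;> simp [ofK]

variable [Module B P₀] [Module k P₀]

theorem corner_mul (p : P₀) (a : OnePointExt k B P₀) :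
    corner k B p * a = corner k B (a.c • p) := by
  ext <;> simp [corner]

theorem corner_smul (b : B) (p : P₀) : corner k B (b • p) = ofB k P₀ b * corner k B p := by
  ext <;> simp [corner, ofB]

theorem ofK_mul (c : k) (a : OnePointExt k B P₀) : ofK B P₀ c * a = ofK B P₀ (c * a.c) := by
  ext <;> simp [ofK]

end Corner

variable {k B P₀ : Type u} [Field k] [Ring B] [Algebra k B] [AddCommGroup P₀] [Module B P₀]
  [Module k P₀] [IsScalarTower k B P₀]

/-! ### Identifying Hom_A(A e_B, X) with e_B X -/

section Evaluation

theorem eB_mem : eB k B P₀ ∈ AeB k B P₀ := Submodule.mem_span_singleton_self _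

theorem mul_eq_of_mem {x : OnePointExt k B P₀} (hx : x ∈ AeB k B P₀) (a : OnePointExt k B P₀) :
    x * a = x * ofB k P₀ a.b + x * corner k B a.p := by
  rw [← mul_add, ← mul_eB_of_mem hx, mul_assoc, mul_assoc]
  congr 1
  ext <;> simp [eB, ofB, corner]

variable {X : Type u} [AddCommGroup X] [Module (OnePointExt k B P₀) X]

variable (k B P₀) in
/-- The homomorphism `A e_B → X` given by right multiplication with `x : X`. -/
def toRestriction (x : X) : AeB k B P₀ →ₗ[OnePointExt k B P₀] X :=
  (LinearMap.toSpanSingleton (OnePointExt k B P₀) X x).comp (AeB k B P₀).subtype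

theorem toRestriction_apply (x : X) (a : AeB k B P₀) : toRestriction k B P₀ x a = a.1 • x := rfl

/-- Evaluation of homomorphisms `A e_B → X` at `e_B`. -/
def evalE (f : AeB k B P₀ →ₗ[OnePointExt k B P₀] X) : X := f ⟨eB k B P₀, eB_mem⟩

/-- Elements of A e_B satisfy a = a e_B, so f is determined by f(e_B). The other composite is only x
↦ e_B x. -/
theorem toRestriction_evalE (f : AeB k B P₀ →ₗ[OnePointExt k B P₀] X) :
    toRestriction k B P₀ (evalE f) = f :=
  LinearMap.ext fun a => by
    rw [toRestriction_apply, evalE, ← map_smul]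
    congr 1
    exact Subtype.ext (mul_eB_of_mem a.2)

theorem evalE_toRestriction (x : X) : evalE (toRestriction k B P₀ x) = eB k B P₀ • x := rfl

theorem toRestriction_add (x y : X) :
    toRestriction k B P₀ (x + y) = toRestriction k B P₀ x + toRestriction k B P₀ y :=
  LinearMap.ext fun a => smul_add a.1 x y

theorem smul_toRestriction_apply (b : B) (f : AeB k B P₀ →ₗ[OnePointExt k B P₀] X)
    (a : AeB k B P₀) : (b • f) a = f ⟨a.1 * ofB k P₀ b, mul_ofB_mem _ _⟩ := rfl

theorem toRestriction_smul (a : OnePointExt k B P₀) (x : X) :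
    toRestriction k B P₀ (a • x) =
      a.b • toRestriction k B P₀ x + toRestriction k B P₀ (corner k B a.p • x) :=
  LinearMap.ext fun y => by
    rw [LinearMap.add_apply, smul_toRestriction_apply]
    simp only [toRestriction_apply, smul_smul, ← add_smul]
    rw [mul_eq_of_mem y.2]

theorem toRestriction_ofB_smul (b : B) (x : X) :
    toRestriction k B P₀ (ofB k P₀ b • x) = b • toRestriction k B P₀ x :=
  LinearMap.ext fun y => by
    rw [smul_toRestriction_apply]
    simp only [toRestriction_apply, smul_smul]

/-- Only the upper left entry of a survives in a e_B, so A acts on e_B X through B. -/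
theorem smul_evalE (a : OnePointExt k B P₀) (f : AeB k B P₀ →ₗ[OnePointExt k B P₀] X) :
    ofB k P₀ a.b • evalE f = evalE (a.b • f) ∧ a • evalE f = evalE (a.b • f) := by
  simp only [evalE, smul_toRestriction_apply, ← map_smul]
  refine ⟨congrArg f (Subtype.ext ?_), congrArg f (Subtype.ext ?_)⟩
  · change ofB k P₀ a.b * eB k B P₀ = eB k B P₀ * ofB k P₀ a.b
    ext <;> simp [eB, ofB]
  · change a * eB k B P₀ = eB k B P₀ * ofB k P₀ a.b
    ext <;> simp [eB, ofB]

end Evaluation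

/-! ### The left adjoint E of restriction -/

section Inflation

variable (k B P₀)

/-- The projection of the one-point extension onto its upper left entry. -/
def projB : OnePointExt k B P₀ →+* B where
  toFun x := x.b
  map_one' := rfl
  map_mul' _ _ := rfl
  map_zero' := rfl
  map_add' _ _ := rfl

/-- The functor from `B`-modules to `A`-modules given by the projection `A → B`. -/
noncomputable abbrev inflation : ModuleCat.{u} B ⥤ ModuleCat.{u} (OnePointExt k B P₀) :=
  ModuleCat.restrictScalars (projB k B P₀)

/-- Inflation is left adjoint to restriction. -/
noncomputable def inflationAdj : inflation k B P₀ ⊣ restriction k B P₀ :=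
  Adjunction.mkOfHomEquiv
    { homEquiv := fun Y X =>
        { toFun := fun g => ModuleCat.ofHom (Y := AeB k B P₀ →ₗ[OnePointExt k B P₀] X)
            { toFun := fun y => toRestriction k B P₀ (g.hom y)
              map_add' := fun y z =>
                (congrArg (toRestriction k B P₀) (map_add g.hom y z)).trans (toRestriction_add _ _)
              map_smul' := fun b y =>
                (congrArg (toRestriction k B P₀) (g.hom.map_smul (ofB k P₀ b) y)).trans
                  (toRestriction_ofB_smul _ _) }
          invFun := fun f => ModuleCat.ofHom (X := (inflation k B P₀).obj Y)
            { toFun := fun y => evalE (X := X) (f.hom y)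
              map_add' := fun y z => congrArg (evalE (X := X)) (f.hom.map_add y z)
              map_smul' := fun a y =>
                (congrArg (evalE (X := X)) (f.hom.map_smul a.b y)).trans (smul_evalE a _).2.symm }
          left_inv := fun g => by
            ext y
            exact (g.hom.map_smul (eB k B P₀) y).symm.trans (congrArg g.hom (one_smul B (y : Y)))
          right_inv := fun f => by
            ext y a
            exact DFunLike.congr_fun (toRestriction_evalE (X := X) (f.hom y)) a }
      homEquiv_naturality_left_symm := fun _ _ => rfl
      homEquiv_naturality_right := fun {Y X X'} f g => by
        ext y
        exact LinearMap.ext fun a => ((g.hom.map_smul _ _).symm) }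

instance : IsIso (inflationAdj k B P₀).unit := by
  rw [NatTrans.isIso_iff_isIso_app]
  intro Y
  rw [ConcreteCategory.isIso_iff_bijective]
  have h : ∀ y : Y, (inflationAdj k B P₀).unit.app Y y =
      toRestriction k B P₀ (X := (inflation k B P₀).obj Y) y := fun y => by
    simp only [inflationAdj, Adjunction.mkOfHomEquiv_unit_app]
    rfl
  constructor
  · intro y z hyz
    rw [h, h] at hyz
    have := congrArg (evalE (X := (inflation k B P₀).obj Y)) hyz
    exact (one_smul B (y : Y)).symm.trans (this.trans (one_smul B (z : Y)))
  · intro f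
    exact ⟨evalE (X := (inflation k B P₀).obj Y) f,
      (h _).trans (toRestriction_evalE (X := (inflation k B P₀).obj Y) f)⟩

end Inflation

/-! ### The right adjoint G of restriction -/

section Coinduction

/-- The underlying type `Y × Hom_B(P₀, Y)` of the `A`-module coinduced from a `B`-module `Y`. -/
@[ext]
structure Coind (k B P₀ Y : Type u) [Ring B] [AddCommGroup P₀] [Module B P₀] [AddCommGroup Y]
    [Module B Y] where
  fst : Y
  snd : P₀ →ₗ[B] Y

namespace Coind

variable {Y : Type u} [AddCommGroup Y] [Module B Y]

/-- The scalar action of `k` on `P₀` by `B`-linear maps. -/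
def scalar (c : k) : P₀ →ₗ[B] P₀ where
  toFun p := c • p
  map_add' := smul_add c
  map_smul' b p := by
    have := IsScalarTower.to_smulCommClass (R := k) (A := B) (M := P₀)
    exact smul_comm c b p

instance : Zero (Coind k B P₀ Y) := ⟨⟨0, 0⟩⟩
instance : Add (Coind k B P₀ Y) := ⟨fun x y => ⟨x.fst + y.fst, x.snd + y.snd⟩⟩
instance : Neg (Coind k B P₀ Y) := ⟨fun x => ⟨-x.fst, -x.snd⟩⟩

instance : AddCommGroup (Coind k B P₀ Y) where
  add_assoc x y z := Coind.ext (add_assoc _ _ _) (add_assoc _ _ _)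
  zero_add x := Coind.ext (zero_add _) (zero_add _)
  add_zero x := Coind.ext (add_zero _) (add_zero _)
  add_comm x y := Coind.ext (add_comm _ _) (add_comm _ _)
  neg_add_cancel x := Coind.ext (neg_add_cancel _) (neg_add_cancel _)
  nsmul := nsmulRec
  zsmul := zsmulRec

/-- Matrices act on columns: the upper right entry by evaluation P₀ × Hom_B(P₀, Y) → Y, the lower
right one through the scalar action on P₀. -/
instance : SMul (OnePointExt k B P₀) (Coind k B P₀ Y) :=
  ⟨fun a x => ⟨a.b • x.fst + x.snd a.p, x.snd.comp (scalar a.c)⟩⟩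

omit [Field k] [Algebra k B] [Module k P₀] [IsScalarTower k B P₀] in
@[simp] theorem add_fst (x y : Coind k B P₀ Y) : (x + y).fst = x.fst + y.fst := rfl
omit [Field k] [Algebra k B] [Module k P₀] [IsScalarTower k B P₀] in
@[simp] theorem add_snd (x y : Coind k B P₀ Y) : (x + y).snd = x.snd + y.snd := rfl
omit [Field k] [Algebra k B] [Module k P₀] [IsScalarTower k B P₀] in
@[simp] theorem zero_fst : (0 : Coind k B P₀ Y).fst = 0 := rfl
omit [Field k] [Algebra k B] [Module k P₀] [IsScalarTower k B P₀] in
@[simp] theorem zero_snd : (0 : Coind k B P₀ Y).snd = 0 := rfl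
@[simp] theorem smul_fst (a : OnePointExt k B P₀) (x : Coind k B P₀ Y) :
    (a • x).fst = a.b • x.fst + x.snd a.p := rfl
@[simp] theorem smul_snd_apply (a : OnePointExt k B P₀) (x : Coind k B P₀ Y) (p : P₀) :
    (a • x).snd p = x.snd (a.c • p) := rfl

instance : Module (OnePointExt k B P₀) (Coind k B P₀ Y) where
  one_smul x := by
    refine Coind.ext ?_ (LinearMap.ext fun p => ?_) <;> simp
  mul_smul a a' x := by
    refine Coind.ext ?_ (LinearMap.ext fun p => ?_)
    · simp [mul_smul, add_assoc]
    · simp [mul_smul, smul_comm a.c a'.c p]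
  smul_zero a := by
    refine Coind.ext ?_ (LinearMap.ext fun p => ?_) <;> simp
  smul_add a x y := by
    refine Coind.ext ?_ (LinearMap.ext fun p => ?_)
    · simp only [smul_fst, add_fst, add_snd, smul_add, LinearMap.add_apply]; abel
    · simp
  add_smul a a' x := by
    refine Coind.ext ?_ (LinearMap.ext fun p => ?_)
    · simp only [smul_fst, add_fst, add_b, add_p, add_smul, map_add]; abel
    · simp [add_smul]
  zero_smul x := by
    refine Coind.ext ?_ (LinearMap.ext fun p => ?_) <;> simp

end Coind

variable (k B P₀)

/-- The coinduction functor `Y ↦ (Y, Hom_B(P₀, Y))` from `B`-modules to `A`-modules. -/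
def coinduction : ModuleCat.{u} B ⥤ ModuleCat.{u} (OnePointExt k B P₀) where
  obj Y := ModuleCat.of _ (Coind k B P₀ Y)
  map {Y Z} g := ModuleCat.ofHom (X := Coind k B P₀ Y) (Y := Coind k B P₀ Z)
    { toFun := fun x => ⟨g.hom x.fst, g.hom.comp x.snd⟩
      map_add' := fun x y => Coind.ext (map_add _ _ _) (LinearMap.comp_add _ _ _)
      map_smul' := fun a x => by
        refine Coind.ext ?_ (LinearMap.ext fun p => ?_) <;> simp }

/-- Restriction is left adjoint to coinduction. -/
def coinductionAdj : restriction k B P₀ ⊣ coinduction k B P₀ :=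
  Adjunction.mkOfHomEquiv
    { homEquiv := fun X Y =>
        { toFun := fun f => ModuleCat.ofHom (Y := Coind k B P₀ Y)
            { toFun := fun x =>
                { fst := f.hom (toRestriction k B P₀ x)
                  snd :=
                    { toFun := fun p => f.hom (toRestriction k B P₀ (corner k B p • x))
                      map_add' := fun p q => by
                        rw [corner_add, add_smul, toRestriction_add]
                        exact f.hom.map_add _ _
                      map_smul' := fun b p => by
                        rw [corner_smul, mul_smul, toRestriction_ofB_smul]
                        exact f.hom.map_smul _ _ } }
              map_add' := fun x y => by
                refine Coind.ext ?_ (LinearMap.ext fun p => ?_)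
                · exact (congrArg f.hom (toRestriction_add x y)).trans (f.hom.map_add _ _)
                · change f.hom (toRestriction k B P₀ (corner k B p • (x + y))) = _
                  rw [smul_add, toRestriction_add]
                  exact f.hom.map_add _ _
              map_smul' := fun a x => by
                refine Coind.ext ?_ (LinearMap.ext fun p => ?_)
                · refine (congrArg f.hom (toRestriction_smul a x)).trans ?_
                  refine (f.hom.map_add _ _).trans ?_
                  exact congrArg (· + _) (f.hom.map_smul a.b _)
                · change f.hom (toRestriction k B P₀ (corner k B p • a • x)) =
                    f.hom (toRestriction k B P₀ (corner k B (a.c • p) • x))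
                  rw [smul_smul, corner_mul] }
          invFun := fun g =>
            let g' : X →ₗ[OnePointExt k B P₀] Coind k B P₀ Y := g.hom
            ModuleCat.ofHom (X := AeB k B P₀ →ₗ[OnePointExt k B P₀] X)
              { toFun := fun φ => (g' (evalE φ)).fst
                map_add' := fun φ ψ => congrArg Coind.fst (g'.map_add (evalE φ) (evalE ψ))
                map_smul' := fun b φ => by
                  refine (congrArg (fun z => (g' z).fst)
                    (smul_evalE (ofB k P₀ b) φ).1.symm).trans ?_
                  rw [map_smul, Coind.smul_fst]
                  simp [ofB] }
          left_inv := fun f => by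
            ext φ
            exact congrArg f.hom (toRestriction_evalE (X := X) φ)
          right_inv := fun g => by
            let g' : X →ₗ[OnePointExt k B P₀] Coind k B P₀ Y := g.hom
            -- The first coordinate of g' z depends only on e_B z; the second is recovered from
            -- first coordinates by acting with upper right corner elements.
            have key : ∀ z : X, (g' (eB k B P₀ • z)).fst = (g' z).fst := fun z => by
              rw [map_smul, Coind.smul_fst]
              simp [eB]
            ext x p
            · exact key x
            · refine (key (corner k B p • x)).trans ?_
              rw [map_smul, Coind.smul_fst]
              simp only [corner, zero_smul, zero_add]
              rfl }
      homEquiv_naturality_left_symm := fun _ _ => rfl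
      homEquiv_naturality_right := fun _ _ => rfl }

/-- In an adjoint triple one outer functor is fully faithful exactly when the other is. -/
instance : IsIso (coinductionAdj k B P₀).counit := by
  let t : Adjunction.Triple (inflation k B P₀) (restriction k B P₀) (coinduction k B P₀) :=
    ⟨inflationAdj k B P₀, coinductionAdj k B P₀⟩
  exact t.isIso_unit_iff_isIso_counit.1 (inferInstanceAs (IsIso (inflationAdj k B P₀).unit))

/-- Projectivity of P₀ enters here: the component in Hom_B(P₀, Z) must lift along Y → Z. -/
instance [Module.Projective B P₀] : (coinduction k B P₀).PreservesEpimorphisms where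
  preserves {Y Z} g hg := by
    rw [ModuleCat.epi_iff_surjective] at hg ⊢
    rintro ⟨z, h⟩
    obtain ⟨y, hy⟩ := hg z
    obtain ⟨h', hh'⟩ := Module.projective_lifting_property g.hom h hg
    exact ⟨(⟨y, h'⟩ : Coind k B P₀ Y), Coind.ext hy hh'⟩

end Coinduction

/-! ### Exactness of the functors and the kernel of restriction -/

section Kernel

variable (k B P₀)

instance : PreservesFiniteLimits (restriction k B P₀) :=
  have := (inflationAdj k B P₀).rightAdjoint_preservesLimits
  inferInstance

instance : PreservesFiniteColimits (restriction k B P₀) :=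
  have := (coinductionAdj k B P₀).leftAdjoint_preservesColimits
  inferInstance

instance : (restriction k B P₀).PreservesZeroMorphisms :=
  have := (coinductionAdj k B P₀).isLeftAdjoint
  inferInstance

instance : PreservesFiniteLimits (inflation k B P₀) where
  preservesFiniteLimits _ _ _ := ⟨inferInstance⟩

variable {k B P₀}

theorem eB_smul_eq_zero {X : ModuleCat.{u} (OnePointExt k B P₀)}
    (hX : IsZero ((restriction k B P₀).obj X)) (x : X) : eB k B P₀ • x = 0 := by
  have := ModuleCat.subsingleton_of_isZero hX
  have h : toRestriction k B P₀ x = 0 :=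
    Subsingleton.elim (α := (restriction k B P₀).obj X) _ _
  rw [← evalE_toRestriction, h]
  rfl

theorem ofK_one_smul {X : ModuleCat.{u} (OnePointExt k B P₀)}
    (hX : IsZero ((restriction k B P₀).obj X)) (x : X) : ofK B P₀ (1 : k) • x = x := by
  conv_rhs => rw [← one_smul (OnePointExt k B P₀) x, ← eB_add_ofK, add_smul,
    eB_smul_eq_zero hX, zero_add]

/-- Since e_B acts as zero, the complementary idempotent acts as the identity, and multiplying a by
it on the left leaves only the lower right entry. -/
theorem smul_eq_ofK_smul {X : ModuleCat.{u} (OnePointExt k B P₀)}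
    (hX : IsZero ((restriction k B P₀).obj X)) (a : OnePointExt k B P₀) (x : X) :
    a • x = ofK B P₀ a.c • x := by
  rw [← ofK_one_smul hX (a • x), smul_smul, ofK_mul, one_mul]

/-- The modules annihilated by the restriction functor are injective. -/
theorem injective_of_isZero_restriction (X : ModuleCat.{u} (OnePointExt k B P₀))
    (hX : IsZero ((restriction k B P₀).obj X)) : Injective X := by
  suffices h : Module.Baer (OnePointExt k B P₀) X by
    have := h.injective
    exact Module.injective_object_of_injective_module _ _
  intro I g
  -- Baer's criterion: g sees only lower right entries. As k is a field, either I contains the lower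
  -- right idempotent, whose image determines the extension, or all these entries vanish on I and g
  -- = 0.
  have key : ∀ (x : OnePointExt k B P₀) (hx : x ∈ I),
      g ⟨x, hx⟩ = g ⟨ofK B P₀ x.c, by simpa [ofK_mul] using I.mul_mem_left (ofK B P₀ 1) hx⟩ := by
    intro x hx
    rw [← ofK_one_smul hX (g ⟨x, hx⟩), ← map_smul]
    have h1 : ofK B P₀ 1 * x = ofK B P₀ x.c := by rw [ofK_mul, one_mul]
    exact congrArg g (Subtype.ext h1)
  by_cases hI : ofK B P₀ (1 : k) ∈ I
  · refine ⟨LinearMap.toSpanSingleton _ _ (g ⟨_, hI⟩), fun x hx => ?_⟩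
    rw [LinearMap.toSpanSingleton_apply, smul_eq_ofK_smul hX, ← map_smul, key x hx]
    congr 1
    exact Subtype.ext ((ofK_mul x.c _).trans (congrArg _ (mul_one x.c)))
  · refine ⟨0, fun x hx => ?_⟩
    have hc : x.c = 0 := by
      by_contra hc
      refine hI ?_
      have := I.mul_mem_left (ofK B P₀ x.c⁻¹) hx
      rwa [ofK_mul, inv_mul_cancel₀ hc] at this
    rw [key x hx, LinearMap.zero_apply, eq_comm]
    convert map_zero g
    rw [hc]
    rfl

variable (k B P₀) in
theorem isZero_restriction_simpleS : IsZero ((restriction k B P₀).obj (simpleS k B P₀)) := by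
  have : Subsingleton (AeB k B P₀ →ₗ[OnePointExt k B P₀] simpleS k B P₀) := by
    refine subsingleton_of_forall_eq 0 fun f => ?_
    have h : eB k B P₀ • evalE f = 0 := zero_mul (M₀ := k) _
    rw [← toRestriction_evalE f, ← toRestriction_evalE (0 : AeB k B P₀ →ₗ[_] simpleS k B P₀),
      ← toRestriction_evalE f, evalE_toRestriction, h]
    rfl
  exact @ModuleCat.isZero_of_subsingleton _ _ ((restriction k B P₀).obj (simpleS k B P₀)) this

theorem isZero_of_hom_simpleS_eq_zero (N : ModuleCat.{u} (OnePointExt k B P₀))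
    (hN : IsZero ((restriction k B P₀).obj N)) (h : ∀ f : simpleS k B P₀ ⟶ N, f = 0) :
    IsZero N := by
  suffices Subsingleton N from ModuleCat.isZero_of_subsingleton _
  refine subsingleton_of_forall_eq 0 fun n => ?_
  -- Each n is the image of 1 under a map S ⟶ N, so n = 0.
  let f : simpleS k B P₀ ⟶ N := ModuleCat.ofHom (X := simpleS k B P₀)
    { toFun := fun c : k => ofK B P₀ c • n
      map_add' := fun c d => by
        rw [← add_smul]
        exact congrArg (· • n) (ofK_add (k := k) c d)
      map_smul' := fun a c => by
        rw [RingHom.id_apply, smul_eq_ofK_smul hN a, smul_smul, ofK_mul]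
        rfl }
  have hf := congrArg (fun g : simpleS k B P₀ ⟶ N => g.hom (1 : k)) (h f)
  exact (ofK_one_smul hN n).symm.trans hf

end Kernel

end OnePointExt

/-! ### The main theorem -/

open TauCot OnePointExt in
theorem mainTheorem10 (k B P₀ : Type u) [Field k] [IsAlgClosed k] [Ring B] [Algebra k B]
    [FiniteDimensional k B] [AddCommGroup P₀] [Module B P₀] [Module k P₀] [IsScalarTower k B P₀]
    [Module.Finite B P₀] [Module.Projective B P₀]
    (𝒞 𝒯 ℱ : ObjectProperty (ModuleCat.{u} (OnePointExt k B P₀)))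
    (h : TauCot.IsTauCotorsionTorsionTriple.{u} 𝒞 𝒯 ℱ) :
    TauCot.IsTauCotorsionTorsionTriple.{u}
      (TauCot.leftPerpOne.{u} (TauCot.Fac ((𝒞 ⊓ 𝒯).map (OnePointExt.restriction k B P₀))))
      (TauCot.Fac ((𝒞 ⊓ 𝒯).map (OnePointExt.restriction k B P₀)))
      ((𝒞 ⊓ 𝒯).map (OnePointExt.restriction k B P₀)).rightOrthogonal ∧
    (𝒯 ≤ OnePointExt.sPerp k B P₀ →
      TauCot.IsTauCotorsionTorsionTriple.{u}
        (𝒞.map (OnePointExt.restriction k B P₀))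
        (𝒯.map (OnePointExt.restriction k B P₀))
        ((ℱ ⊓ OnePointExt.sPerp k B P₀).map (OnePointExt.restriction k B P₀)) ∧
      TauCot.leftPerpOne.{u} (TauCot.Fac ((𝒞 ⊓ 𝒯).map (OnePointExt.restriction k B P₀))) =
        𝒞.map (OnePointExt.restriction k B P₀) ∧
      TauCot.Fac ((𝒞 ⊓ 𝒯).map (OnePointExt.restriction k B P₀)) =
        𝒯.map (OnePointExt.restriction k B P₀) ∧
      ((𝒞 ⊓ 𝒯).map (OnePointExt.restriction k B P₀)).rightOrthogonal =
        (ℱ ⊓ OnePointExt.sPerp k B P₀).map (OnePointExt.restriction k B P₀)) := by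
  have htriple := h.map (coinductionAdj k B P₀) injective_of_isZero_restriction
    (inflationAdj k B P₀)
  have hfac : Fac ((𝒞 ⊓ 𝒯).map (restriction k B P₀)) = 𝒯.map (restriction k B P₀) :=
    fac_eq htriple.torsionPair (ObjectProperty.map_monotone inf_le_right _)
      (exists_epi_map fun _ hX => h.tauCotorsionPair.exists_epi hX)
  have hperp := htriple.tauCotorsionPair.eq_leftPerpOne.symm
  have horth := rightOrthogonal_map_eq (coinductionAdj k B P₀) injective_of_isZero_restriction
    (isZero_restriction_simpleS k B P₀) isZero_of_hom_simpleS_eq_zero h (sPerp k B P₀)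
    fun _ => Iff.rfl
  -- This turns the first triple into the transported triple; `horth` then rewrites its torsion-free
  -- class.
  rw [hfac, hperp]
  exact ⟨htriple, fun _ => ⟨horth ▸ htriple, rfl, rfl, horth⟩⟩
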